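/- **Theorem 2.1.** Let $n$ be a positive integer, let $\Pi_n\subset\mathbb R^n$ be the closed simplex of probability vectors, $\Pi_{n,++}$ the subset of those with all coordinates positive, and $\partial\Pi_n=\Pi_n\setminus\Pi_{n,++}$. For $v\in\mathbb R^n$ let $D(v)$ be the diagonal matrix with diagonal $v$. Let $A$ be a real $n\times n$ matrix with nonnegative entries and no zero row or zero column, and let $a\in\Pi_{n,++}$. Then $$\Phi_{A,a}(x)=D(x)\,A\,D(A^{\top}x)^{-1}a$$ defines a smooth map $\Phi_{A,a}:\Pi_{n,++}\to\Pi_{n,++}$, and the following hold. 1. Suppose that all entries of $A$ are positive. Then $\Phi_{A,a}$ extends to a continuous map $\Pi_n\to\Pi_n$ which maps $\partial\Pi_n$ into $\partial\Pi_n$, and $\Phi_{A,a}$ is a diffeomorphism of $\Pi_{n,++}$ onto itself. Consequently the discrete Schrödinger bridge problem is uniquely solvable: for every $b\in\Pi_{n,++}$ there are vectors $u,v,x,y$ with positive entries such that $$v=A^{\top}u,\qquad y=Ax,\qquad a=v\circ x,\qquad b=u\circ y$$ ($\circ$ is the entrywise product), and every positive solution has the form $(tu,tv,t^{-1}x,t^{-1}y)$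 with $t>0$. Equivalently, there are diagonal matrices $D_1,D_2$ with positive diagonal entries such that $B=D_1AD_2$ is column stochastic and $Ba=b$, and the pair $(D_1,D_2)$ is unique up to replacing it by $(tD_1,t^{-1}D_2)$, $t>0$. 2. Suppose that $AA^{\top}$ is irreducible. Then $\Phi_{A,a}(\Pi_{n,++})$ is an open subset of $\Pi_{n,++}$, and $\Phi_{A,a}$ is a diffeomorphism of $\Pi_{n,++}$ onto $\Phi_{A,a}(\Pi_{n,++})$. -/

import Mathlib

open scoped Matrix ContDiff

/-- The open simplex `Π_{n,++}` of positive probability vectors. The closed simplex `Π_n` is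
`stdSimplex ℝ (Fin n)`. -/
def openSimplex (n : ℕ) : Set (Fin n → ℝ) :=
  {x | x ∈ stdSimplex ℝ (Fin n) ∧ ∀ i, 0 < x i}

/-- The boundary `∂Π_n` of the simplex: the closed simplex minus the open simplex. -/
def simplexBoundary (n : ℕ) : Set (Fin n → ℝ) :=
  stdSimplex ℝ (Fin n) \ openSimplex n

/-- The matrix `Φ_A(x) = D(x) A D(Aᵀ x)⁻¹`. -/
noncomputable def scalingMatrix {n : ℕ} (A : Matrix (Fin n) (Fin n) ℝ) (x : Fin n → ℝ) :
    Matrix (Fin n) (Fin n) ℝ :=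
  Matrix.diagonal x * A * (Matrix.diagonal (Aᵀ *ᵥ x))⁻¹

/-- The map `Φ_{A,a}(x) = Φ_A(x) a`. -/
noncomputable def scalingMap {n : ℕ} (A : Matrix (Fin n) (Fin n) ℝ) (a x : Fin n → ℝ) :
    Fin n → ℝ :=
  scalingMatrix A x *ᵥ a

/-- Smoothness of a map on an arbitrary subset `S` of a normed space: near each point of `S` the
map is the restriction to `S` of a `C^∞` map defined on an open set of the ambient space. On an
embedded submanifold this is smoothness for the manifold structure. -/
def SmoothOnSubset {E F : Type*} [NormedAddCommGroup E] [NormedSpace ℝ E]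
    [NormedAddCommGroup F] [NormedSpace ℝ F] (f : E → F) (S : Set E) : Prop :=
  ∀ x ∈ S, ∃ U : Set E, IsOpen U ∧ x ∈ U ∧
    ∃ g : E → F, ContDiffOn ℝ ∞ g U ∧ Set.EqOn f g (S ∩ U)

/-- `f` restricts to a diffeomorphism of the subset `S` onto the subset `T`: a smooth bijection
of `S` onto `T` with smooth inverse. -/
def IsDiffeomorphismOn {E F : Type*} [NormedAddCommGroup E] [NormedSpace ℝ E]
    [NormedAddCommGroup F] [NormedSpace ℝ F] (f : E → F) (S : Set E) (T : Set F) : Prop :=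
  Set.MapsTo f S T ∧ SmoothOnSubset f S ∧
    ∃ g : F → E, Set.MapsTo g T S ∧ SmoothOnSubset g T ∧ Set.InvOn g f S T

/-- `u, v, x, y` are positive vectors solving the discrete Schrödinger bridge system
`v = Aᵀ u`, `y = A x`, `a = v ∘ x`, `b = u ∘ y` (`∘` is the entrywise product). -/
def IsBridgeSolution {n : ℕ} (A : Matrix (Fin n) (Fin n) ℝ) (a b u v x y : Fin n → ℝ) : Prop :=
  (∀ i, 0 < u i) ∧ (∀ i, 0 < v i) ∧ (∀ i, 0 < x i) ∧ (∀ i, 0 < y i) ∧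
    v = Aᵀ *ᵥ u ∧ y = A *ᵥ x ∧ a = v * x ∧ b = u * y

/-- `d₁, d₂` are the diagonals of positive diagonal matrices `D₁, D₂` such that `B = D₁ A D₂` is
(column) stochastic and `B a = b`. -/
def IsBridgeScaling {n : ℕ} (A : Matrix (Fin n) (Fin n) ℝ) (a b d₁ d₂ : Fin n → ℝ) : Prop :=
  (∀ i, 0 < d₁ i) ∧ (∀ i, 0 < d₂ i) ∧
    Matrix.diagonal d₁ * A * Matrix.diagonal d₂ ∈ Matrix.colStochastic ℝ (Fin n) ∧
    (Matrix.diagonal d₁ * A * Matrix.diagonal d₂) *ᵥ a = b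

/-!
Write `T x = Aᵀ x` and let `S(x, z) = A D(a / (T x ∘ T z)) Aᵀ`, a symmetric nonnegative matrix which
is irreducible when `A Aᵀ` is. Then `Φ(z) = z ∘ S(x, z) x` and `Φ(x) = x ∘ S(x, z) z`, so
`Φ(z) - Φ(x) = (z - x) ∘ S(x, z) x - x ∘ S(x, z) (z - x)`; letting `z` tend to `x` gives
`DΦ(x) h = h ∘ S(x, x) x - x ∘ S(x, x) h`. Hence both the injectivity of `Φ` up to scaling and
`ker DΦ(x) = ℝ x` are instances of one maximum principle: if `S` is nonnegative and irreducible,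
`x > 0` and `z ∘ S x = x ∘ S z`, then `z` is a multiple of `x`, because the indices at which `z / x`
is maximal are closed under the edges of `S`. The inverse function theorem, applied to the
extension of `Φ` to the orthant that is homogeneous of degree one, gives the diffeomorphism onto an
open image. If all entries of `A` are positive, `Φ` extends to the compact simplex and preserves its
boundary, so the image of the open simplex is also relatively closed, hence everything by
connectedness. Finally, the bridge problem for `b` is the equation `Φ(u) = b`.
-/

open Filter Matrix Topology Finset

/-- The open positive orthant `ℝ^ι_{++}`. -/
def posOrthant (ι : Type*) : Set (ι → ℝ) := {x | ∀ i, 0 < x i}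

/-- The open simplex of positive probability vectors indexed by a finite type. -/
def positiveSimplex (ι : Type*) [Fintype ι] : Set (ι → ℝ) :=
  {x | x ∈ stdSimplex ℝ ι ∧ x ∈ posOrthant ι}

theorem posOrthant_eq_pi (ι : Type*) : posOrthant ι = Set.univ.pi fun _ => Set.Ioi 0 := by
  ext x
  simp only [posOrthant, Set.mem_ofPred_eq, Set.mem_univ_pi, Set.mem_Ioi]

theorem isOpen_posOrthant (ι : Type*) [Finite ι] : IsOpen (posOrthant ι) := by
  rw [posOrthant_eq_pi]
  exact isOpen_set_pi Set.finite_univ fun _ _ => isOpen_Ioi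

theorem convex_positiveSimplex (ι : Type*) [Fintype ι] : Convex ℝ (positiveSimplex ι) := by
  have hpos : Convex ℝ (posOrthant ι) := by
    rw [posOrthant_eq_pi]
    exact convex_pi fun _ _ => convex_Ioi 0
  exact (convex_stdSimplex ℝ ι).inter hpos

theorem positiveSimplex_nonempty (ι : Type*) [Fintype ι] [Nonempty ι] :
    (positiveSimplex ι).Nonempty :=
  ⟨(stdSimplex.barycenter : stdSimplex ℝ ι), stdSimplex.barycenter.2, fun _ =>
    inv_pos.2 (Nat.cast_pos.2 Fintype.card_pos)⟩

theorem nonempty_of_mem_stdSimplex {ι : Type*} [Fintype ι] {x : ι → ℝ} (hx : x ∈ stdSimplex ℝ ι) :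
    Nonempty ι := by
  by_contra! h
  simpa using hx.2

theorem sum_pos_of_mem_posOrthant {ι : Type*} [Fintype ι] [Nonempty ι] {x : ι → ℝ}
    (hx : x ∈ posOrthant ι) : 0 < ∑ i, x i :=
  sum_pos (fun i _ => hx i) univ_nonempty

theorem div_mem_posOrthant {κ : Type*} {v w : κ → ℝ} (hv : v ∈ posOrthant κ)
    (hw : w ∈ posOrthant κ) : v / w ∈ posOrthant κ := fun j =>
  div_pos (hv j) (hw j)

section Nonnegative

variable {ι κ : Type*} [Fintype κ] {B : Matrix ι κ ℝ} {x : κ → ℝ}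

theorem mulVec_mem_posOrthant (hB : ∀ i j, 0 ≤ B i j) (hrow : ∀ i, ∃ j, B i j ≠ 0)
    (hx : x ∈ posOrthant κ) : B *ᵥ x ∈ posOrthant ι := fun i => by
  obtain ⟨j, hj⟩ := hrow i
  exact sum_pos' (fun k _ => mul_nonneg (hB i k) (hx k).le)
    ⟨j, mem_univ j, mul_pos ((hB i j).lt_of_ne' hj) (hx j)⟩

theorem mulVec_mem_posOrthant_of_mem_stdSimplex (hB : ∀ i j, 0 < B i j)
    (hx : x ∈ stdSimplex ℝ κ) : B *ᵥ x ∈ posOrthant ι := fun i => by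
  obtain ⟨j, -, hj⟩ : ∃ j ∈ univ, 0 < x j :=
    exists_lt_of_sum_lt (by simp [hx.2])
  exact sum_pos' (fun k _ => mul_nonneg (hB i k).le (hx.1 k)) ⟨j, mem_univ j, mul_pos (hB i j) hj⟩

theorem transpose_mulVec_mem_posOrthant {A : Matrix κ ι ℝ} (hA : ∀ i j, 0 ≤ A i j)
    (hcol : ∀ j, ∃ i, A i j ≠ 0) (hx : x ∈ posOrthant κ) : Aᵀ *ᵥ x ∈ posOrthant ι :=
  mulVec_mem_posOrthant (fun j i => hA i j) hcol hx

end Nonnegative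

section Irreducible

variable {ι : Type*}

theorem isIrreducible_of_pos_imp_pos {S T : Matrix ι ι ℝ} (hS : S.IsIrreducible)
    (hT : ∀ i j, 0 ≤ T i j) (h : ∀ i j, 0 < S i j → 0 < T i j) : T.IsIrreducible := by
  have hpath {i j : ι} (p : @Quiver.Path ι S.toQuiver i j) :
      ∃ q : @Quiver.Path ι T.toQuiver i j,
        @Quiver.Path.length ι T.toQuiver i j q = @Quiver.Path.length ι S.toQuiver i j p := by
    induction p with
    | nil => exact ⟨@Quiver.Path.nil ι T.toQuiver i, rfl⟩
    | cons _ e ih =>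
      obtain ⟨q, hq⟩ := ih
      exact ⟨@Quiver.Path.cons ι T.toQuiver _ _ _ q ⟨h _ _ e.down⟩, congrArg (· + 1) hq⟩
  refine ⟨hT, fun i j => ?_⟩
  obtain ⟨p, hp⟩ := hS.connected i j
  obtain ⟨q, hq⟩ := hpath p
  exact ⟨q, hq.symm ▸ hp⟩

theorem isIrreducible_of_pos {S : Matrix ι ι ℝ} (hS : ∀ i j, 0 < S i j) : S.IsIrreducible :=
  ⟨fun i j => (hS i j).le, fun i j =>
    ⟨@Quiver.Path.cons ι S.toQuiver _ _ _ (@Quiver.Path.nil ι S.toQuiver i) ⟨hS i j⟩, one_pos⟩⟩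

theorem isIrreducible_mul_diagonal_mul_transpose {κ : Type*} [Fintype κ] [DecidableEq κ]
    {A : Matrix ι κ ℝ} (hA : ∀ i j, 0 ≤ A i j) (hirr : (A * Aᵀ).IsIrreducible) {w : κ → ℝ}
    (hw : w ∈ posOrthant κ) : (A * diagonal w * Aᵀ).IsIrreducible := by
  have hentry (i k) : (A * diagonal w * Aᵀ) i k = ∑ j, w j * (A i j * A k j) := by
    rw [Matrix.mul_apply]
    exact sum_congr rfl fun j _ => by rw [mul_diagonal, transpose_apply]; ring
  have hnonneg (i k j) : 0 ≤ A i j * A k j := mul_nonneg (hA i j) (hA k j)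
  refine isIrreducible_of_pos_imp_pos hirr (fun i k => ?_) fun i k hik => ?_
  · rw [hentry]
    exact sum_nonneg fun j _ => mul_nonneg (hw j).le (hnonneg i k j)
  · obtain ⟨j, -, hj⟩ : ∃ j ∈ univ, 0 < A i j * A k j :=
      exists_lt_of_sum_lt (by simpa [Matrix.mul_apply] using hik)
    rw [hentry]
    exact sum_pos' (fun j _ => mul_nonneg (hw j).le (hnonneg i k j))
      ⟨j, mem_univ j, mul_pos (hw j) hj⟩

theorem forall_of_isIrreducible {S : Matrix ι ι ℝ} (hS : S.IsIrreducible) {p : ι → Prop}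
    (hp : ∀ i k, 0 < S i k → p i → p k) {i : ι} (hi : p i) (k : ι) : p k := by
  let : Quiver ι := S.toQuiver
  obtain ⟨q, -⟩ := hS.connected i k
  induction q with
  | nil => exact hi
  | cons _ e ih => exact hp _ _ e.down ih

theorem exists_eq_smul_of_mul_mulVec_eq [Fintype ι] {S : Matrix ι ι ℝ} (hS : S.IsIrreducible)
    {x z : ι → ℝ} (hx : x ∈ posOrthant ι) (h : z * (S *ᵥ x) = x * (S *ᵥ z)) :
    ∃ t : ℝ, z = t • x := by
  cases isEmpty_or_nonempty ι
  · exact ⟨0, Subsingleton.elim _ _⟩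
  obtain ⟨l, hl⟩ := Finite.exists_max fun i => z i / x i
  let t := z l / x l
  have hle (k) : 0 ≤ t * x k - z k := sub_nonneg.2 ((div_le_iff₀ (hx k)).1 (hl k))
  refine ⟨t, funext <| forall_of_isIrreducible hS (p := fun i => z i = t * x i) ?_
    (div_mul_cancel₀ _ (hx l).ne').symm⟩
  intro i k hik hi
  have hsum : ∑ k, S i k * (t * x k - z k) = 0 := by
    have hzero : x i * ∑ k, S i k * (t * x k - z k) = z i * (S *ᵥ x) i - x i * (S *ᵥ z) i := by
      simp only [hi, mulVec, dotProduct, mul_sum, ← sum_sub_distrib]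
      exact sum_congr rfl fun k _ => by ring
    rw [show z i * (S *ᵥ x) i = x i * (S *ᵥ z) i from congrFun h i, sub_self] at hzero
    exact (mul_eq_zero.1 hzero).resolve_left (hx i).ne'
  have hterm := (sum_eq_zero_iff_of_nonneg fun k _ => mul_nonneg (hS.nonneg i k) (hle k)).1 hsum k
    (mem_univ k)
  exact (sub_eq_zero.1 ((mul_eq_zero.1 hterm).resolve_left hik.ne')).symm

end Irreducible

section InverseFunction

variable {E F : Type*} [NormedAddCommGroup E] [NormedAddCommGroup F]

theorem exists_openPartialHomeomorph_of_injOn {𝕜 : Type*} [RCLike 𝕜] [NormedSpace 𝕜 E]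
    [NormedSpace 𝕜 F] [CompleteSpace E] {n : WithTop ℕ∞} (hn : n ≠ 0) {f : E → F} {S : Set E}
    (hS : IsOpen S) (hf : ContDiffOn 𝕜 n f S) (hinj : Set.InjOn f S)
    (hderiv : ∀ x ∈ S, ∃ f' : E ≃L[𝕜] F, HasFDerivAt f (f' : E →L[𝕜] F) x) :
    ∃ e : OpenPartialHomeomorph E F,
      e.source = S ∧ ⇑e = f ∧ ContDiffOn 𝕜 n e.symm e.target := by
  have hfat (x) (hx : x ∈ S) : ContDiffAt 𝕜 n f x := hf.contDiffAt (hS.mem_nhds hx)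
  have hopen : IsOpenMap (S.domRestrict f) := by
    refine isOpenMap_iff_nhds_le.2 fun ⟨x, hx⟩ => ?_
    obtain ⟨f', hf'⟩ := hderiv x hx
    change 𝓝 (f x) ≤ _
    rw [← ((hfat x hx).hasStrictFDerivAt' hf' hn).map_nhds_eq_of_equiv,
      ← map_nhds_subtype_coe_eq_nhds hx (hS.mem_nhds hx), Filter.map_map]
    rfl
  let e := OpenPartialHomeomorph.ofContinuousOpenRestrict (hinj.toPartialEquiv f S)
    hf.continuousOn hopen hS
  refine ⟨e, rfl, rfl, fun y hy => ?_⟩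
  have hy' : e.symm y ∈ S := e.map_target hy
  obtain ⟨f', hf'⟩ := hderiv _ hy'
  exact (e.contDiffAt_symm hy hf' (hfat _ hy')).contDiffWithinAt

theorem exists_hasFDerivAt_equiv_of_injective {𝕜 : Type*} [NontriviallyNormedField 𝕜]
    [CompleteSpace 𝕜] [NormedSpace 𝕜 E] [FiniteDimensional 𝕜 E] {f : E → E} {x : E}
    (hf : DifferentiableAt 𝕜 f x) (hinj : Function.Injective (fderiv 𝕜 f x)) :
    ∃ f' : E ≃L[𝕜] E, HasFDerivAt f (f' : E →L[𝕜] E) x :=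
  ⟨(LinearEquiv.ofInjectiveEndo (fderiv 𝕜 f x : E →ₗ[𝕜] E) hinj).toContinuousLinearEquiv,
    hf.hasFDerivAt⟩

theorem isDiffeomorphismOn_image [NormedSpace ℝ E] [NormedSpace ℝ F]
    {e : OpenPartialHomeomorph E F} (he : ContDiffOn ℝ ∞ e e.source)
    (he' : ContDiffOn ℝ ∞ e.symm e.target) {f : E → F} {S : Set E} (hS : S ⊆ e.source)
    (hf : Set.EqOn f e S) : IsDiffeomorphismOn f S (f '' S) := by
  have hleft : Set.LeftInvOn e.symm f S := fun x hx => by rw [hf hx, e.left_inv (hS hx)]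
  refine ⟨Set.mapsTo_image f S, fun x hx => ⟨_, e.open_source, hS hx, e, he, hf.mono ?_⟩, e.symm,
    hleft.mapsTo (Set.surjOn_image f S), ?_, hleft, hleft.rightInvOn_image⟩
  · exact Set.inter_subset_left
  · rintro _ ⟨x, hx, rfl⟩
    exact ⟨_, e.open_target, hf hx ▸ e.map_source (hS hx), e.symm, he', fun _ _ => rfl⟩

theorem image_eq_of_isOpen_of_mapsTo_compl {X : Type*} [TopologicalSpace X] [T2Space X]
    {f : X → X} {K S U : Set X} (hK : IsCompact K) (hf : ContinuousOn f K)
    (hS : IsPreconnected S) (hne : S.Nonempty) (hSK : S ⊆ K) (hcompl : Set.MapsTo f (K \ S) Sᶜ)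
    (hU : IsOpen U) (himage : f '' S = U ∩ S) : f '' S = S := by
  have hinter : f '' K ∩ S ⊆ f '' S := by
    rintro _ ⟨⟨x, hx, rfl⟩, hfx⟩
    exact ⟨x, by_contra fun hxS => hcompl ⟨hx, hxS⟩ hfx, rfl⟩
  have hcover : S ⊆ U ∪ (f '' K)ᶜ := fun y hy => or_iff_not_imp_right.2 fun hyK =>
    (himage ▸ hinter ⟨not_not.1 hyK, hy⟩ : y ∈ U ∩ S).1
  have hdisj : S ∩ (U ∩ (f '' K)ᶜ) = ∅ := by
    refine Set.eq_empty_of_forall_notMem fun y ⟨hyS, hyU, hyK⟩ => hyK ?_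
    exact Set.image_mono hSK (himage ▸ ⟨hyU, hyS⟩ : y ∈ f '' S)
  rcases isPreconnected_iff_subset_of_disjoint.1 hS U _ hU
    (hK.image_of_continuousOn hf).isClosed.isOpen_compl hcover hdisj with hSU | hSK'
  · rw [himage, Set.inter_eq_right.2 hSU]
  · obtain ⟨x, hx⟩ := hne
    have hfx : f x ∈ S := (himage ▸ Set.mem_image_of_mem f hx : f x ∈ U ∩ S).2
    exact absurd (Set.mem_image_of_mem f (hSK hx)) (hSK' hfx)

end InverseFunction

section ScalingFormula

variable {ι κ : Type*} [Fintype ι] [Fintype κ]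

/-- The formula `x ∘ A (a / Aᵀ x)` for `Φ_{A,a}(x)`, with entrywise division in place of the matrix
inverse: at a zero of a single coordinate of `Aᵀ x` only that coordinate of the quotient is junk. -/
noncomputable def scalingFormula (A : Matrix ι κ ℝ) (a : κ → ℝ) (x : ι → ℝ) : ι → ℝ :=
  x * (A *ᵥ (a / (Aᵀ *ᵥ x)))

/-- The symmetric matrix `S(x, z) = A D(a / (Aᵀ x ∘ Aᵀ z)) Aᵀ` through which the increments of
`Φ_{A,a}` are expressed. -/
noncomputable def coupling [DecidableEq κ] (A : Matrix ι κ ℝ) (a : κ → ℝ) (x z : ι → ℝ) :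
    Matrix ι ι ℝ :=
  A * diagonal (a / ((Aᵀ *ᵥ x) * (Aᵀ *ᵥ z))) * Aᵀ

variable {A : Matrix ι κ ℝ} {a : κ → ℝ} {x z : ι → ℝ}

theorem sum_scalingFormula (hx : ∀ j, (Aᵀ *ᵥ x) j ≠ 0) :
    ∑ i, scalingFormula A a x i = ∑ j, a j := by
  change x ⬝ᵥ (A *ᵥ (a / (Aᵀ *ᵥ x))) = _
  rw [dotProduct_mulVec, ← mulVec_transpose]
  exact sum_congr rfl fun j _ => mul_div_cancel₀ _ (hx j)

theorem scalingFormula_mem_posOrthant (hA : ∀ i j, 0 ≤ A i j) (hrow : ∀ i, ∃ j, A i j ≠ 0)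
    (ha : a ∈ posOrthant κ) (hx : x ∈ posOrthant ι) (hTx : Aᵀ *ᵥ x ∈ posOrthant κ) :
    scalingFormula A a x ∈ posOrthant ι := fun i =>
  mul_pos (hx i) (mulVec_mem_posOrthant hA hrow (div_mem_posOrthant ha hTx) i)

theorem scalingFormula_mem_stdSimplex (hA : ∀ i j, 0 ≤ A i j) (ha : a ∈ stdSimplex ℝ κ)
    (hx : x ∈ stdSimplex ℝ ι) (hTx : Aᵀ *ᵥ x ∈ posOrthant κ) :
    scalingFormula A a x ∈ stdSimplex ℝ ι := by
  refine ⟨fun i => mul_nonneg (hx.1 i) (sum_nonneg fun j _ => ?_), ?_⟩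
  · exact mul_nonneg (hA i j) (div_nonneg (ha.1 j) (hTx j).le)
  · rw [sum_scalingFormula fun j => (hTx j).ne', ha.2]

theorem mem_posOrthant_of_scalingFormula_mem_posOrthant (hx : ∀ i, 0 ≤ x i)
    (h : scalingFormula A a x ∈ posOrthant ι) : x ∈ posOrthant ι := fun i =>
  (hx i).lt_of_ne' fun hi => (h i).ne' (mul_eq_zero_of_left hi _)

theorem contDiff_mulVec {n : WithTop ℕ∞} (B : Matrix ι κ ℝ) : ContDiff ℝ n fun y => B *ᵥ y :=
  B.mulVecLin.toContinuousLinearMap.contDiff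

theorem contDiffAt_scalingFormula {n : WithTop ℕ∞} (hx : ∀ j, (Aᵀ *ᵥ x) j ≠ 0) :
    ContDiffAt ℝ n (scalingFormula A a) x := by
  have hdiv : ContDiffAt ℝ n (fun y => a / (Aᵀ *ᵥ y)) x := contDiffAt_pi.2 fun j =>
    contDiffAt_const.div (contDiffAt_pi.1 (contDiff_mulVec Aᵀ).contDiffAt j) (hx j)
  exact contDiffAt_id.mul ((contDiff_mulVec A).contDiffAt.comp x hdiv)

section Coupling

variable [DecidableEq κ]

theorem coupling_comm (A : Matrix ι κ ℝ) (a : κ → ℝ) (x z : ι → ℝ) :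
    coupling A a x z = coupling A a z x := by
  rw [coupling, coupling, mul_comm (Aᵀ *ᵥ x)]

theorem transpose_coupling (A : Matrix ι κ ℝ) (a : κ → ℝ) (x z : ι → ℝ) :
    (coupling A a x z)ᵀ = coupling A a x z := by
  simp only [coupling, transpose_mul, transpose_transpose, diagonal_transpose, Matrix.mul_assoc]

theorem coupling_mulVec (A : Matrix ι κ ℝ) (a : κ → ℝ) (x z y : ι → ℝ) :
    coupling A a x z *ᵥ y = A *ᵥ (a / ((Aᵀ *ᵥ x) * (Aᵀ *ᵥ z)) * (Aᵀ *ᵥ y)) := by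
  rw [coupling, ← mulVec_mulVec, ← mulVec_mulVec]
  exact congrArg (A *ᵥ ·) (funext fun j => mulVec_diagonal _ _ j)

theorem continuousAt_coupling_mulVec (hx : ∀ j, (Aᵀ *ᵥ x) j ≠ 0) (hz : ∀ j, (Aᵀ *ᵥ z) j ≠ 0)
    (y : ι → ℝ) : ContinuousAt (fun w => coupling A a x w *ᵥ y) z := by
  have hweight : ContinuousAt (fun w => a / ((Aᵀ *ᵥ x) * (Aᵀ *ᵥ w))) z := continuousAt_pi.2 fun j =>
    continuousAt_const.div (by fun_prop) (mul_ne_zero (hx j) (hz j))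
  simp only [coupling_mulVec]
  exact (contDiff_mulVec (n := 0) A).continuous.continuousAt.comp
    (hweight.mul continuousAt_const)

theorem scalingFormula_eq_mul_coupling_mulVec (hx : ∀ j, (Aᵀ *ᵥ x) j ≠ 0) :
    scalingFormula A a z = z * (coupling A a x z *ᵥ x) := by
  rw [coupling_mulVec, scalingFormula]
  congr 2
  funext j
  exact (div_mul_eq_div_div_swap (a j) _ _ ▸ div_mul_cancel₀ _ (hx j)).symm

theorem scalingFormula_sub_scalingFormula (hx : ∀ j, (Aᵀ *ᵥ x) j ≠ 0)
    (hz : ∀ j, (Aᵀ *ᵥ z) j ≠ 0) :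
    scalingFormula A a z - scalingFormula A a x =
      (z - x) * (coupling A a x z *ᵥ x) - x * (coupling A a x z *ᵥ (z - x)) := by
  rw [scalingFormula_eq_mul_coupling_mulVec hx, scalingFormula_eq_mul_coupling_mulVec hz,
    coupling_comm A a z x, mulVec_sub]
  ring

theorem isIrreducible_coupling (hA : ∀ i j, 0 ≤ A i j) (hirr : (A * Aᵀ).IsIrreducible)
    (ha : a ∈ posOrthant κ) (hx : Aᵀ *ᵥ x ∈ posOrthant κ) (hz : Aᵀ *ᵥ z ∈ posOrthant κ) :
    (coupling A a x z).IsIrreducible :=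
  isIrreducible_mul_diagonal_mul_transpose hA hirr
    (div_mem_posOrthant ha fun j => mul_pos (hx j) (hz j))

theorem fderiv_scalingFormula_apply (hx : ∀ j, (Aᵀ *ᵥ x) j ≠ 0) (h : ι → ℝ) :
    fderiv ℝ (scalingFormula A a) x h =
      h * (coupling A a x x *ᵥ x) - x * (coupling A a x x *ᵥ h) := by
  have hline : Tendsto (fun t : ℝ => x + t • h) (𝓝[≠] 0) (𝓝 x) :=
    tendsto_nhdsWithin_of_tendsto_nhds <|
      Continuous.tendsto' (by fun_prop) 0 x (by rw [zero_smul, add_zero])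
  have hne : ∀ᶠ t : ℝ in 𝓝[≠] 0, ∀ j, (Aᵀ *ᵥ (x + t • h)) j ≠ 0 := by
    have hcont (j) : ContinuousAt (fun y => (Aᵀ *ᵥ y) j) x := by fun_prop
    exact hline.eventually (eventually_all.2 fun j => (hcont j).eventually_ne (hx j))
  have hcoupling (y : ι → ℝ) := (continuousAt_coupling_mulVec (a := a) hx hx y).tendsto.comp hline
  have hslope : ∀ᶠ t in 𝓝[≠] (0 : ℝ),
      h * (coupling A a x (x + t • h) *ᵥ x) - x * (coupling A a x (x + t • h) *ᵥ h) =
        t⁻¹ • (scalingFormula A a (x + t • h) - scalingFormula A a x) := by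
    filter_upwards [hne, self_mem_nhdsWithin] with t ht ht0
    rw [scalingFormula_sub_scalingFormula hx ht, add_sub_cancel_left, mulVec_smul, smul_mul_assoc,
      mul_smul_comm, ← smul_sub, inv_smul_smul₀ ht0]
  have hderiv : HasLineDerivAt ℝ (scalingFormula A a)
      (h * (coupling A a x x *ᵥ x) - x * (coupling A a x x *ᵥ h)) x h :=
    hasLineDerivAt_iff_tendsto_slope_zero.2 <| Tendsto.congr' hslope <|
      (tendsto_const_nhds.mul (hcoupling x)).sub (tendsto_const_nhds.mul (hcoupling h))
  have hdiff := (contDiffAt_scalingFormula (a := a) (n := 1) hx).differentiableAt one_ne_zero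
  exact hdiff.lineDeriv_eq_fderiv.symm.trans hderiv.lineDeriv

end Coupling

theorem sum_fderiv_scalingFormula (hx : ∀ j, (Aᵀ *ᵥ x) j ≠ 0) (h : ι → ℝ) :
    ∑ i, fderiv ℝ (scalingFormula A a) x h i = 0 := by
  classical
  have hsymm : h ⬝ᵥ (coupling A a x x *ᵥ x) = x ⬝ᵥ (coupling A a x x *ᵥ h) := by
    rw [dotProduct_comm, ← vecMul_transpose, transpose_coupling, dotProduct_mulVec]
  rw [fderiv_scalingFormula_apply hx]
  exact (sum_sub_distrib _ _).trans (sub_eq_zero.2 hsymm)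

theorem exists_pos_smul_of_scalingFormula_eq [Nonempty ι] (hA : ∀ i j, 0 ≤ A i j)
    (hcol : ∀ j, ∃ i, A i j ≠ 0) (hirr : (A * Aᵀ).IsIrreducible) (ha : a ∈ posOrthant κ)
    (hx : x ∈ posOrthant ι) (hz : z ∈ posOrthant ι)
    (h : scalingFormula A a x = scalingFormula A a z) : ∃ t : ℝ, 0 < t ∧ z = t • x := by
  classical
  have hTx := transpose_mulVec_mem_posOrthant hA hcol hx
  have hTz := transpose_mulVec_mem_posOrthant hA hcol hz
  obtain ⟨t, rfl⟩ := exists_eq_smul_of_mul_mulVec_eq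
    (isIrreducible_coupling hA hirr ha hTx hTz) hx <| by
      rw [← scalingFormula_eq_mul_coupling_mulVec fun j => (hTx j).ne', ← h,
        scalingFormula_eq_mul_coupling_mulVec fun j => (hTz j).ne', coupling_comm]
  exact ⟨t, pos_of_mul_pos_left (hz (Classical.arbitrary ι)) (hx _).le, rfl⟩

end ScalingFormula

section HomogeneousScaling

variable {ι κ : Type*} [Fintype ι] [Fintype κ]

/-- The extension of `Φ_{A,a}` from the simplex to the orthant that is homogeneous of degree one.
Since `Φ_{A,a}` itself is homogeneous of degree zero, it is this extension that the inverse
function theorem applies to. -/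
noncomputable def homogeneousScaling (A : Matrix ι κ ℝ) (a : κ → ℝ) (x : ι → ℝ) : ι → ℝ :=
  (∑ i, x i) • scalingFormula A a x

variable {A : Matrix ι κ ℝ} {a : κ → ℝ} {x : ι → ℝ}

theorem homogeneousScaling_of_sum_eq_one (hx : ∑ i, x i = 1) :
    homogeneousScaling A a x = scalingFormula A a x := by
  rw [homogeneousScaling, hx, one_smul]

theorem sum_homogeneousScaling (ha : ∑ j, a j = 1) (hx : ∀ j, (Aᵀ *ᵥ x) j ≠ 0) :
    ∑ i, homogeneousScaling A a x i = ∑ i, x i := by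
  simp only [homogeneousScaling, Pi.smul_apply, smul_eq_mul]
  rw [← mul_sum, sum_scalingFormula hx, ha, mul_one]

theorem contDiffAt_homogeneousScaling {n : WithTop ℕ∞} (hx : ∀ j, (Aᵀ *ᵥ x) j ≠ 0) :
    ContDiffAt ℝ n (homogeneousScaling A a) x :=
  (ContDiff.sum fun i _ => contDiff_apply ℝ ℝ i).contDiffAt.smul (contDiffAt_scalingFormula hx)

theorem fderiv_homogeneousScaling_apply (hx : ∀ j, (Aᵀ *ᵥ x) j ≠ 0) (h : ι → ℝ) :
    fderiv ℝ (homogeneousScaling A a) x h =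
      (∑ i, x i) • fderiv ℝ (scalingFormula A a) x h + (∑ i, h i) • scalingFormula A a x := by
  have hsum : HasFDerivAt (fun y : ι → ℝ => ∑ i, y i)
      (∑ i, ContinuousLinearMap.proj (R := ℝ) (φ := fun _ : ι => ℝ) i) x :=
    HasFDerivAt.fun_sum fun i _ => hasFDerivAt_apply i x
  have hdiff := (contDiffAt_scalingFormula (a := a) (n := 1) hx).differentiableAt one_ne_zero
  have hprod : HasFDerivAt (homogeneousScaling A a) _ x := hsum.smul hdiff.hasFDerivAt
  rw [hprod.fderiv]
  simp

theorem injOn_homogeneousScaling (hA : ∀ i j, 0 ≤ A i j) (hcol : ∀ j, ∃ i, A i j ≠ 0)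
    (hirr : (A * Aᵀ).IsIrreducible) (ha : a ∈ positiveSimplex κ) :
    Set.InjOn (homogeneousScaling A a) (posOrthant ι) := by
  classical
  intro x hx z hz h
  cases isEmpty_or_nonempty ι
  · exact Subsingleton.elim _ _
  have hsum : ∑ i, x i = ∑ i, z i := by
    have hTx := transpose_mulVec_mem_posOrthant hA hcol hx
    have hTz := transpose_mulVec_mem_posOrthant hA hcol hz
    rw [← sum_homogeneousScaling ha.1.2 fun j => (hTx j).ne', h,
      sum_homogeneousScaling ha.1.2 fun j => (hTz j).ne']
  have hpos := sum_pos_of_mem_posOrthant hx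
  have hformula : scalingFormula A a x = scalingFormula A a z := by
    rw [homogeneousScaling, homogeneousScaling, ← hsum] at h
    exact smul_right_injective _ hpos.ne' h
  obtain ⟨t, -, rfl⟩ := exists_pos_smul_of_scalingFormula_eq hA hcol hirr ha.2 hx hz hformula
  have ht : 1 * ∑ i, x i = t * ∑ i, x i := by simpa [mul_sum] using hsum
  rw [← mul_right_cancel₀ hpos.ne' ht, one_smul]

theorem injective_fderiv_homogeneousScaling (hA : ∀ i j, 0 ≤ A i j) (hcol : ∀ j, ∃ i, A i j ≠ 0)
    (hirr : (A * Aᵀ).IsIrreducible) (ha : a ∈ positiveSimplex κ) (hx : x ∈ posOrthant ι) :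
    Function.Injective (fderiv ℝ (homogeneousScaling A a) x) := by
  classical
  refine (injective_iff_map_eq_zero _).2 fun h hzero => ?_
  cases isEmpty_or_nonempty ι
  · exact Subsingleton.elim _ _
  have hTx := transpose_mulVec_mem_posOrthant hA hcol hx
  have hTx' (j) : (Aᵀ *ᵥ x) j ≠ 0 := (hTx j).ne'
  have hpos := sum_pos_of_mem_posOrthant hx
  rw [fderiv_homogeneousScaling_apply hTx'] at hzero
  have hsum : ∑ i, h i = 0 := by
    simpa [sum_add_distrib, ← mul_sum, sum_fderiv_scalingFormula hTx', sum_scalingFormula hTx',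
      ha.1.2] using congrArg (fun y => ∑ i, y i) hzero
  have hker : fderiv ℝ (scalingFormula A a) x h = 0 := by
    simpa [hsum, hpos.ne'] using hzero
  rw [fderiv_scalingFormula_apply hTx', sub_eq_zero] at hker
  obtain ⟨t, rfl⟩ := exists_eq_smul_of_mul_mulVec_eq
    (isIrreducible_coupling hA hirr ha.2 hTx hTx) hx hker
  have ht : t * ∑ i, x i = 0 := by simpa [mul_sum] using hsum
  rw [(mul_eq_zero.1 ht).resolve_right hpos.ne', zero_smul]

theorem exists_openPartialHomeomorph_homogeneousScaling (hA : ∀ i j, 0 ≤ A i j)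
    (hcol : ∀ j, ∃ i, A i j ≠ 0) (hirr : (A * Aᵀ).IsIrreducible) (ha : a ∈ positiveSimplex κ) :
    ∃ e : OpenPartialHomeomorph (ι → ℝ) (ι → ℝ), e.source = posOrthant ι ∧
      ⇑e = homogeneousScaling A a ∧ ContDiffOn ℝ ∞ e e.source ∧
      ContDiffOn ℝ ∞ e.symm e.target := by
  have hsmooth {n : WithTop ℕ∞} : ContDiffOn ℝ n (homogeneousScaling A a) (posOrthant ι) :=
    fun x hx => (contDiffAt_homogeneousScaling fun j =>
      (transpose_mulVec_mem_posOrthant hA hcol hx j).ne').contDiffWithinAt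
  obtain ⟨e, hsource, hcoe, hsymm⟩ := exists_openPartialHomeomorph_of_injOn (n := ∞) (by simp)
    (isOpen_posOrthant ι) hsmooth (injOn_homogeneousScaling hA hcol hirr ha) fun x hx =>
      exists_hasFDerivAt_equiv_of_injective
        ((hsmooth (n := 1)).differentiableOn one_ne_zero |>.differentiableAt
          ((isOpen_posOrthant ι).mem_nhds hx))
        (injective_fderiv_homogeneousScaling hA hcol hirr ha hx)
  exact ⟨e, hsource, hcoe, hsource ▸ hcoe ▸ hsmooth, hsymm⟩

end HomogeneousScaling

section DiagonalScaling

variable {ι κ : Type*} [Fintype ι] [Fintype κ] [DecidableEq ι] [DecidableEq κ]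

theorem diagonal_mul_mul_diagonal_mulVec (A : Matrix ι κ ℝ) (d₁ : ι → ℝ) (d₂ y : κ → ℝ) :
    (diagonal d₁ * A * diagonal d₂) *ᵥ y = d₁ * (A *ᵥ (d₂ * y)) := by
  rw [← mulVec_mulVec, ← mulVec_mulVec]
  funext i
  rw [mulVec_diagonal, funext fun j => mulVec_diagonal d₂ y j]
  rfl

theorem one_vecMul_diagonal_mul_mul_diagonal (A : Matrix ι κ ℝ) (d₁ : ι → ℝ) (d₂ : κ → ℝ) :
    1 ᵥ* (diagonal d₁ * A * diagonal d₂) = (Aᵀ *ᵥ d₁) * d₂ := by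
  have hone : 1 ᵥ* diagonal d₁ = d₁ := funext fun i => by
    rw [vecMul_diagonal, Pi.one_apply, one_mul]
  rw [← vecMul_vecMul, ← vecMul_vecMul, hone, mulVec_transpose]
  exact funext fun j => vecMul_diagonal _ _ j

end DiagonalScaling

section RectangularScaling

variable {ι κ : Type*} [Fintype ι] [Fintype κ] [DecidableEq ι] [DecidableEq κ]

/-- The map `Φ_{A,a}(x) = D(x) A D(Aᵀ x)⁻¹ a` for a rectangular matrix `A`. -/
noncomputable def rectScalingMap (A : Matrix ι κ ℝ) (a : κ → ℝ) (x : ι → ℝ) : ι → ℝ :=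
  (diagonal x * A * (diagonal (Aᵀ *ᵥ x))⁻¹) *ᵥ a

variable {A : Matrix ι κ ℝ} {a : κ → ℝ}

theorem rectScalingMap_eq_scalingFormula {x : ι → ℝ} (hx : ∀ j, (Aᵀ *ᵥ x) j ≠ 0) :
    rectScalingMap A a x = scalingFormula A a x := by
  have hinv : (diagonal (Aᵀ *ᵥ x))⁻¹ = diagonal (Aᵀ *ᵥ x)⁻¹ := by
    refine inv_eq_left_inv ?_
    rw [diagonal_mul_diagonal, ← diagonal_one]
    exact congrArg diagonal (funext fun j => inv_mul_cancel₀ (hx j))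
  rw [rectScalingMap, hinv, diagonal_mul_mul_diagonal_mulVec, scalingFormula, div_eq_inv_mul]

theorem eqOn_rectScalingMap_scalingFormula (hA : ∀ i j, 0 ≤ A i j) (hcol : ∀ j, ∃ i, A i j ≠ 0) :
    Set.EqOn (rectScalingMap A a) (scalingFormula A a) (posOrthant ι) := fun _ hx =>
  rectScalingMap_eq_scalingFormula fun j => (transpose_mulVec_mem_posOrthant hA hcol hx j).ne'

theorem mapsTo_rectScalingMap (hA : ∀ i j, 0 ≤ A i j) (hrow : ∀ i, ∃ j, A i j ≠ 0)
    (hcol : ∀ j, ∃ i, A i j ≠ 0) (ha : a ∈ positiveSimplex κ) :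
    Set.MapsTo (rectScalingMap A a) (positiveSimplex ι) (positiveSimplex ι) := fun x hx => by
  have hTx := transpose_mulVec_mem_posOrthant hA hcol hx.2
  rw [eqOn_rectScalingMap_scalingFormula hA hcol hx.2]
  exact ⟨scalingFormula_mem_stdSimplex hA ha.1 hx.1 hTx,
    scalingFormula_mem_posOrthant hA hrow ha.2 hx.2 hTx⟩

theorem smoothOnSubset_rectScalingMap (hA : ∀ i j, 0 ≤ A i j) (hcol : ∀ j, ∃ i, A i j ≠ 0) :
    SmoothOnSubset (rectScalingMap A a) (positiveSimplex ι) := fun _ hx =>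
  ⟨posOrthant ι, isOpen_posOrthant ι, hx.2, scalingFormula A a,
    fun _ hy => (contDiffAt_scalingFormula fun j =>
      (transpose_mulVec_mem_posOrthant hA hcol hy j).ne').contDiffWithinAt,
    (eqOn_rectScalingMap_scalingFormula hA hcol).mono Set.inter_subset_right⟩

theorem exists_openPartialHomeomorph_rectScalingMap (hA : ∀ i j, 0 ≤ A i j)
    (hrow : ∀ i, ∃ j, A i j ≠ 0) (hcol : ∀ j, ∃ i, A i j ≠ 0) (hirr : (A * Aᵀ).IsIrreducible)
    (ha : a ∈ positiveSimplex κ) :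
    ∃ e : OpenPartialHomeomorph (ι → ℝ) (ι → ℝ), positiveSimplex ι ⊆ e.source ∧
      Set.EqOn (rectScalingMap A a) e (positiveSimplex ι) ∧
      ContDiffOn ℝ ∞ e e.source ∧ ContDiffOn ℝ ∞ e.symm e.target ∧
      rectScalingMap A a '' positiveSimplex ι = e.target ∩ positiveSimplex ι := by
  obtain ⟨e, hsource, hcoe, he, hsymm⟩ :=
    exists_openPartialHomeomorph_homogeneousScaling hA hcol hirr ha
  have hsub : positiveSimplex ι ⊆ e.source := hsource ▸ fun x hx => hx.2
  have heq : Set.EqOn (rectScalingMap A a) e (positiveSimplex ι) := fun x hx => by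
    rw [eqOn_rectScalingMap_scalingFormula hA hcol hx.2, hcoe,
      homogeneousScaling_of_sum_eq_one hx.1.2]
  refine ⟨e, hsub, heq, he, hsymm, Set.Subset.antisymm ?_ ?_⟩
  · rintro _ ⟨x, hx, rfl⟩
    exact ⟨heq hx ▸ e.map_source (hsub hx), mapsTo_rectScalingMap hA hrow hcol ha hx⟩
  · rintro y ⟨hy, hySimplex⟩
    have hpos : e.symm y ∈ posOrthant ι := hsource ▸ e.map_target hy
    have hsum : ∑ i, e.symm y i = 1 := by
      rw [← sum_homogeneousScaling ha.1.2 fun j =>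
        (transpose_mulVec_mem_posOrthant hA hcol hpos j).ne', ← hcoe, e.right_inv hy,
        hySimplex.1.2]
    have hmem : e.symm y ∈ positiveSimplex ι := ⟨⟨fun i => (hpos i).le, hsum⟩, hpos⟩
    exact ⟨e.symm y, hmem, (heq hmem).trans (e.right_inv hy)⟩

theorem isDiffeomorphismOn_rectScalingMap_image (hA : ∀ i j, 0 ≤ A i j)
    (hrow : ∀ i, ∃ j, A i j ≠ 0) (hcol : ∀ j, ∃ i, A i j ≠ 0) (hirr : (A * Aᵀ).IsIrreducible)
    (ha : a ∈ positiveSimplex κ) :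
    IsDiffeomorphismOn (rectScalingMap A a) (positiveSimplex ι)
      (rectScalingMap A a '' positiveSimplex ι) :=
  have ⟨_, hsub, heq, he, hsymm, _⟩ :=
    exists_openPartialHomeomorph_rectScalingMap hA hrow hcol hirr ha
  isDiffeomorphismOn_image he hsymm hsub heq

theorem exists_isOpen_image_rectScalingMap_eq_inter (hA : ∀ i j, 0 ≤ A i j)
    (hrow : ∀ i, ∃ j, A i j ≠ 0) (hcol : ∀ j, ∃ i, A i j ≠ 0) (hirr : (A * Aᵀ).IsIrreducible)
    (ha : a ∈ positiveSimplex κ) :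
    ∃ U : Set (ι → ℝ), IsOpen U ∧
      rectScalingMap A a '' positiveSimplex ι = U ∩ positiveSimplex ι :=
  have ⟨e, _, _, _, _, himage⟩ := exists_openPartialHomeomorph_rectScalingMap hA hrow hcol hirr ha
  ⟨e.target, e.open_target, himage⟩

end RectangularScaling

section PositiveMatrix

theorem isIrreducible_mul_transpose_of_pos {ι κ : Type*} [Fintype κ] [Nonempty κ]
    {A : Matrix ι κ ℝ} (hA : ∀ i j, 0 < A i j) :
    (A * Aᵀ).IsIrreducible :=
  isIrreducible_of_pos fun i k =>
    sum_pos (fun j _ => mul_pos (hA i j) (hA k j)) univ_nonempty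

variable {ι κ : Type*} [Fintype ι] [Fintype κ] {A : Matrix ι κ ℝ} {a : κ → ℝ}

theorem continuousOn_scalingFormula (hA : ∀ i j, 0 < A i j) :
    ContinuousOn (scalingFormula A a) (stdSimplex ℝ ι) := fun _ hx =>
  (contDiffAt_scalingFormula (n := 0) fun j =>
    (mulVec_mem_posOrthant_of_mem_stdSimplex (fun j i => hA i j) hx j).ne').continuousAt
      |>.continuousWithinAt

theorem mapsTo_scalingFormula_stdSimplex (hA : ∀ i j, 0 < A i j) (ha : a ∈ stdSimplex ℝ κ) :
    Set.MapsTo (scalingFormula A a) (stdSimplex ℝ ι) (stdSimplex ℝ ι) := fun _ hx =>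
  scalingFormula_mem_stdSimplex (fun i j => (hA i j).le) ha hx
    (mulVec_mem_posOrthant_of_mem_stdSimplex (fun j i => hA i j) hx)

theorem mapsTo_scalingFormula_compl_positiveSimplex (A : Matrix ι κ ℝ) (a : κ → ℝ) :
    Set.MapsTo (scalingFormula A a) (stdSimplex ℝ ι \ positiveSimplex ι) (positiveSimplex ι)ᶜ :=
  fun _ hx h => hx.2 ⟨hx.1, mem_posOrthant_of_scalingFormula_mem_posOrthant hx.1.1 h.2⟩

theorem image_rectScalingMap_eq_positiveSimplex [Nonempty ι] [DecidableEq ι] [DecidableEq κ]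
    (hA : ∀ i j, 0 < A i j) (ha : a ∈ positiveSimplex κ) :
    rectScalingMap A a '' positiveSimplex ι = positiveSimplex ι := by
  have hA' (i j) : 0 ≤ A i j := (hA i j).le
  have : Nonempty κ := nonempty_of_mem_stdSimplex ha.1
  have hrow (i) : ∃ j, A i j ≠ 0 := ⟨Classical.arbitrary κ, (hA _ _).ne'⟩
  have hcol (j) : ∃ i, A i j ≠ 0 := ⟨Classical.arbitrary ι, (hA _ _).ne'⟩
  obtain ⟨U, hU, himage⟩ := exists_isOpen_image_rectScalingMap_eq_inter hA' hrow hcol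
    (isIrreducible_mul_transpose_of_pos hA) ha
  have heq : rectScalingMap A a '' positiveSimplex ι = scalingFormula A a '' positiveSimplex ι :=
    Set.image_congr fun x hx => eqOn_rectScalingMap_scalingFormula hA' hcol hx.2
  rw [heq] at himage ⊢
  exact image_eq_of_isOpen_of_mapsTo_compl (isCompact_stdSimplex ℝ ι)
    (continuousOn_scalingFormula hA) (convex_positiveSimplex ι).isPreconnected
    (positiveSimplex_nonempty ι) Set.inter_subset_left
    (mapsTo_scalingFormula_compl_positiveSimplex A a) hU himage

end PositiveMatrix

section Bridge

variable {ι κ : Type*} [Fintype ι] [Fintype κ]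

/-- The discrete Schrödinger bridge system `v = Aᵀ u`, `y = A x`, `a = v ∘ x`, `b = u ∘ y` in
positive vectors, for a rectangular matrix `A`. -/
def IsRectBridgeSolution (A : Matrix ι κ ℝ) (a : κ → ℝ) (b u : ι → ℝ) (v x : κ → ℝ)
    (y : ι → ℝ) : Prop :=
  (∀ i, 0 < u i) ∧ (∀ j, 0 < v j) ∧ (∀ j, 0 < x j) ∧ (∀ i, 0 < y i) ∧
    v = Aᵀ *ᵥ u ∧ y = A *ᵥ x ∧ a = v * x ∧ b = u * y

/-- Positive diagonals `d₁, d₂` such that `B = D₁ A D₂` is column stochastic and `B a = b`, for a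
rectangular matrix `A`; column stochasticity is spelled out because `Matrix.colStochastic` is
restricted to square matrices. -/
def IsRectBridgeScaling [DecidableEq ι] [DecidableEq κ] (A : Matrix ι κ ℝ) (a : κ → ℝ)
    (b d₁ : ι → ℝ) (d₂ : κ → ℝ) : Prop :=
  (∀ i, 0 < d₁ i) ∧ (∀ j, 0 < d₂ j) ∧
    ((∀ i j, 0 ≤ (diagonal d₁ * A * diagonal d₂) i j) ∧
      1 ᵥ* (diagonal d₁ * A * diagonal d₂) = 1) ∧
    (diagonal d₁ * A * diagonal d₂) *ᵥ a = b

variable {A : Matrix ι κ ℝ} {a : κ → ℝ} {b : ι → ℝ}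

theorem isRectBridgeSolution_iff (hA : ∀ i j, 0 ≤ A i j) (hrow : ∀ i, ∃ j, A i j ≠ 0)
    (hcol : ∀ j, ∃ i, A i j ≠ 0) (ha : a ∈ posOrthant κ) {u : ι → ℝ} {v x : κ → ℝ} {y : ι → ℝ} :
    IsRectBridgeSolution A a b u v x y ↔ u ∈ posOrthant ι ∧ scalingFormula A a u = b ∧
      v = Aᵀ *ᵥ u ∧ x = a / (Aᵀ *ᵥ u) ∧ y = A *ᵥ x := by
  constructor
  · rintro ⟨hu, hv, -, -, rfl, rfl, rfl, rfl⟩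
    have hx : (Aᵀ *ᵥ u) * x / (Aᵀ *ᵥ u) = x :=
      funext fun j => mul_div_cancel_left₀ (x j) (hv j).ne'
    exact ⟨hu, by rw [scalingFormula, hx], rfl, hx.symm, rfl⟩
  · rintro ⟨hu, rfl, rfl, rfl, rfl⟩
    have hv := transpose_mulVec_mem_posOrthant hA hcol hu
    have hx := div_mem_posOrthant ha hv
    exact ⟨hu, hv, hx, mulVec_mem_posOrthant hA hrow hx, rfl, rfl,
      funext fun j => (mul_div_cancel₀ (a j) (hv j).ne').symm, rfl⟩

theorem isRectBridgeScaling_iff [DecidableEq ι] [DecidableEq κ] (hA : ∀ i j, 0 ≤ A i j)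
    (hcol : ∀ j, ∃ i, A i j ≠ 0) {d₁ : ι → ℝ} {d₂ : κ → ℝ} :
    IsRectBridgeScaling A a b d₁ d₂ ↔
      d₁ ∈ posOrthant ι ∧ scalingFormula A a d₁ = b ∧ d₂ = (Aᵀ *ᵥ d₁)⁻¹ := by
  have hinv : (Aᵀ *ᵥ d₁) * d₂ = 1 → d₂ = (Aᵀ *ᵥ d₁)⁻¹ := fun h =>
    funext fun j => eq_inv_of_mul_eq_one_right (congrFun h j)
  constructor
  · rintro ⟨h₁, -, ⟨-, hsum⟩, hb⟩
    have h₂ := hinv ((one_vecMul_diagonal_mul_mul_diagonal A d₁ d₂).symm.trans hsum)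
    refine ⟨h₁, ?_, h₂⟩
    rw [← hb, diagonal_mul_mul_diagonal_mulVec, h₂, scalingFormula, div_eq_inv_mul]
  · rintro ⟨h₁, hb, h₂⟩
    have hv := transpose_mulVec_mem_posOrthant hA hcol h₁
    have h₂pos (j) : 0 < d₂ j := h₂ ▸ inv_pos.2 (hv j)
    refine ⟨h₁, h₂pos, ⟨fun i j => ?_, ?_⟩, ?_⟩
    · rw [mul_diagonal, diagonal_mul]
      exact mul_nonneg (mul_nonneg (h₁ i).le (hA i j)) (h₂pos j).le
    · rw [one_vecMul_diagonal_mul_mul_diagonal, h₂]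
      exact funext fun j => mul_inv_cancel₀ (hv j).ne'
    · rw [diagonal_mul_mul_diagonal_mulVec, h₂, ← div_eq_inv_mul, ← hb, scalingFormula]

section Uniqueness

variable [Nonempty ι] (hA : ∀ i j, 0 ≤ A i j) (hcol : ∀ j, ∃ i, A i j ≠ 0)
  (hirr : (A * Aᵀ).IsIrreducible) (ha : a ∈ posOrthant κ) {u : ι → ℝ} (hu : u ∈ posOrthant ι)
  (hb : scalingFormula A a u = b)

include hA hcol hirr ha hu hb

theorem exists_isRectBridgeSolution (hrow : ∀ i, ∃ j, A i j ≠ 0) :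
    ∃ (u : ι → ℝ) (v x : κ → ℝ) (y : ι → ℝ), IsRectBridgeSolution A a b u v x y ∧
      ∀ u' v' x' y', IsRectBridgeSolution A a b u' v' x' y' →
        ∃ t : ℝ, 0 < t ∧ u' = t • u ∧ v' = t • v ∧ x' = t⁻¹ • x ∧ y' = t⁻¹ • y := by
  refine ⟨u, _, _, _, (isRectBridgeSolution_iff hA hrow hcol ha).2 ⟨hu, hb, rfl, rfl, rfl⟩,
    fun u' v' x' y' h => ?_⟩
  obtain ⟨hu', hb', rfl, rfl, rfl⟩ := (isRectBridgeSolution_iff hA hrow hcol ha).1 h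
  obtain ⟨t, ht, rfl⟩ :=
    exists_pos_smul_of_scalingFormula_eq hA hcol hirr ha hu hu' (hb.trans hb'.symm)
  have hx : a / (Aᵀ *ᵥ (t • u)) = t⁻¹ • (a / (Aᵀ *ᵥ u)) := by
    rw [mulVec_smul]
    funext j
    simp [field]
  exact ⟨t, ht, rfl, mulVec_smul _ _ _, hx, by rw [hx, mulVec_smul]⟩

theorem exists_isRectBridgeScaling [DecidableEq ι] [DecidableEq κ] :
    ∃ (d₁ : ι → ℝ) (d₂ : κ → ℝ), IsRectBridgeScaling A a b d₁ d₂ ∧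
      ∀ d₁' d₂', IsRectBridgeScaling A a b d₁' d₂' →
        ∃ t : ℝ, 0 < t ∧ d₁' = t • d₁ ∧ d₂' = t⁻¹ • d₂ := by
  refine ⟨u, _, (isRectBridgeScaling_iff hA hcol).2 ⟨hu, hb, rfl⟩, fun u' d₂' h => ?_⟩
  obtain ⟨hu', hb', rfl⟩ := (isRectBridgeScaling_iff hA hcol).1 h
  obtain ⟨t, ht, rfl⟩ :=
    exists_pos_smul_of_scalingFormula_eq hA hcol hirr ha hu hu' (hb.trans hb'.symm)
  refine ⟨t, ht, rfl, ?_⟩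
  rw [mulVec_smul]
  exact funext fun j => mul_inv _ _

end Uniqueness

end Bridge

theorem theorem2p1_general {ι κ : Type*} [Fintype ι] [Fintype κ] [DecidableEq ι] [DecidableEq κ]
    (A : Matrix ι κ ℝ) (a : κ → ℝ) (hA : ∀ i j, 0 ≤ A i j)
    (hrow : ∀ i, ∃ j, A i j ≠ 0) (hcol : ∀ j, ∃ i, A i j ≠ 0) (ha : a ∈ positiveSimplex κ) :
    (Set.MapsTo (rectScalingMap A a) (positiveSimplex ι) (positiveSimplex ι) ∧
      SmoothOnSubset (rectScalingMap A a) (positiveSimplex ι)) ∧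
    ((∀ i j, 0 < A i j) →
      (∃ F : (ι → ℝ) → (ι → ℝ),
        Set.EqOn F (rectScalingMap A a) (positiveSimplex ι) ∧
        ContinuousOn F (stdSimplex ℝ ι) ∧
        Set.MapsTo F (stdSimplex ℝ ι) (stdSimplex ℝ ι) ∧
        Set.MapsTo F (stdSimplex ℝ ι \ positiveSimplex ι)
          (stdSimplex ℝ ι \ positiveSimplex ι)) ∧
      IsDiffeomorphismOn (rectScalingMap A a) (positiveSimplex ι) (positiveSimplex ι) ∧
      ∀ b ∈ positiveSimplex ι,
        (∃ (u : ι → ℝ) (v x : κ → ℝ) (y : ι → ℝ), IsRectBridgeSolution A a b u v x y ∧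
          ∀ u' v' x' y', IsRectBridgeSolution A a b u' v' x' y' →
            ∃ t : ℝ, 0 < t ∧ u' = t • u ∧ v' = t • v ∧ x' = t⁻¹ • x ∧ y' = t⁻¹ • y) ∧
        (∃ (d₁ : ι → ℝ) (d₂ : κ → ℝ), IsRectBridgeScaling A a b d₁ d₂ ∧
          ∀ d₁' d₂', IsRectBridgeScaling A a b d₁' d₂' →
            ∃ t : ℝ, 0 < t ∧ d₁' = t • d₁ ∧ d₂' = t⁻¹ • d₂)) ∧
    ((A * Aᵀ).IsIrreducible →
      IsDiffeomorphismOn (rectScalingMap A a) (positiveSimplex ι)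
        (rectScalingMap A a '' positiveSimplex ι) ∧
      ∃ U : Set (ι → ℝ), IsOpen U ∧
        rectScalingMap A a '' positiveSimplex ι = U ∩ positiveSimplex ι) := by
  have hdiffeo (hirr : (A * Aᵀ).IsIrreducible) :=
    isDiffeomorphismOn_rectScalingMap_image hA hrow hcol hirr ha
  refine ⟨⟨mapsTo_rectScalingMap hA hrow hcol ha, smoothOnSubset_rectScalingMap hA hcol⟩,
    fun hpos => ?_, fun hirr =>
      ⟨hdiffeo hirr, exists_isOpen_image_rectScalingMap_eq_inter hA hrow hcol hirr ha⟩⟩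
  have : Nonempty κ := nonempty_of_mem_stdSimplex ha.1
  have : Nonempty ι := (hcol (Classical.arbitrary κ)).nonempty
  have hirr := isIrreducible_mul_transpose_of_pos hpos
  have himage := image_rectScalingMap_eq_positiveSimplex hpos ha
  have heq := eqOn_rectScalingMap_scalingFormula (a := a) hA hcol
  have hclosed := mapsTo_scalingFormula_stdSimplex hpos ha.1
  refine ⟨⟨scalingFormula A a, fun x hx => (heq hx.2).symm, continuousOn_scalingFormula hpos,
    hclosed, fun x hx => ⟨hclosed hx.1, mapsTo_scalingFormula_compl_positiveSimplex A a hx⟩⟩,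
    himage.subst (motive := IsDiffeomorphismOn _ _) (hdiffeo hirr), fun b hb => ?_⟩
  obtain ⟨u, hu, rfl⟩ := himage.ge hb
  have hub := (heq hu.2).symm
  exact ⟨exists_isRectBridgeSolution hA hcol hirr ha.2 hu.2 hub hrow,
    exists_isRectBridgeScaling hA hcol hirr ha.2 hu.2 hub⟩

theorem theorem2p1 (n : ℕ) (A : Matrix (Fin n) (Fin n) ℝ) (a : Fin n → ℝ)
    (hA : ∀ i j, 0 ≤ A i j)
    (hrow : ∀ i, ∃ j, A i j ≠ 0) (hcol : ∀ j, ∃ i, A i j ≠ 0)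
    (ha : a ∈ openSimplex n) :
    -- the map is a well-defined smooth self-map of the open simplex
    (Set.MapsTo (scalingMap A a) (openSimplex n) (openSimplex n) ∧
      SmoothOnSubset (scalingMap A a) (openSimplex n)) ∧
    -- part 1
    ((∀ i j, 0 < A i j) →
      (∃ F : (Fin n → ℝ) → (Fin n → ℝ),
        Set.EqOn F (scalingMap A a) (openSimplex n) ∧
        ContinuousOn F (stdSimplex ℝ (Fin n)) ∧
        Set.MapsTo F (stdSimplex ℝ (Fin n)) (stdSimplex ℝ (Fin n)) ∧
        Set.MapsTo F (simplexBoundary n) (simplexBoundary n)) ∧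
      IsDiffeomorphismOn (scalingMap A a) (openSimplex n) (openSimplex n) ∧
      -- unique solvability of the bridge problem, as a system and as a matrix scaling
      ∀ b ∈ openSimplex n,
        (∃ u v x y : Fin n → ℝ, IsBridgeSolution A a b u v x y ∧
          ∀ u' v' x' y' : Fin n → ℝ, IsBridgeSolution A a b u' v' x' y' →
            ∃ t : ℝ, 0 < t ∧ u' = t • u ∧ v' = t • v ∧ x' = t⁻¹ • x ∧ y' = t⁻¹ • y) ∧
        (∃ d₁ d₂ : Fin n → ℝ, IsBridgeScaling A a b d₁ d₂ ∧
          ∀ d₁' d₂' : Fin n → ℝ, IsBridgeScaling A a b d₁' d₂' →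
            ∃ t : ℝ, 0 < t ∧ d₁' = t • d₁ ∧ d₂' = t⁻¹ • d₂)) ∧
    -- part 2
    ((A * Aᵀ).IsIrreducible →
      IsDiffeomorphismOn (scalingMap A a) (openSimplex n)
        (scalingMap A a '' openSimplex n) ∧
      ∃ U : Set (Fin n → ℝ), IsOpen U ∧
        scalingMap A a '' openSimplex n = U ∩ openSimplex n) :=
  theorem2p1_general A a hA hrow hcol ha
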